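/- **Model.** There are $P\ge 1$ processors. Each processor owns finitely many (possibly no) serial tasks, each of a positive integer size (the time it takes); the tasks owned by a processor are the leaves of a given binary tree (arbitrary, in particular possibly balanced in the number of leaves). Let $T_1$ be the sum of the sizes of all serial tasks, and let the span $T_\infty$ be $\lceil\lg P\rceil$ plus the largest height of the $P$ trees plus the size of the largest serial task (that is, the height of the binary tree obtained by connecting the $P$ roots by a binary tree of height $\lceil \lg P\rceil$, plus the largest size). The *localized work-stealing algorithm* runs in synchronous timesteps. Initially each processor holds its own tree, and each processor has an empty list (of other processors that are working on its work). In a timestep, every processor that holds a tree executes one unit of the leftmost serial task of that tree (completed tasks are removed), and every processor that holds nothing (a free processor) makes one steal attempt, which takes the timestep. If the list of the free processor is nonempty, it *steals back*: its target is uniformly random in its list. Otherwise it makes a *general steal*: its target is uniformly random among the processors that hold a tree. Given the past, the choices of different processors are independent. An attempt on a processor $q$ takes the right branch at the root of the tree held by $q$ (the branch $q$ is not working on); it fails if the tree of $q$ is a single leaf or $q$ holds nothing, or, for a steal-back, if the tree held by $q$ is not owned by the stealer. If several attempts compete for the same branch, an arbitrary one of them succeeds (the choice may depend on the whole history, including the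 current choices) and the others fail. A processor that succeeds in stealing work of another owner is added to the list of that owner; when a steal-back fails because its target has no branch of the owner's work to give away, the target is removed from the owner's list. The *execution time* $T$ is the number of timesteps until all tasks are completed. **Theorem.** The expected running time of the localized work-stealing algorithm, including scheduling overhead, is $T_1/P+O(T_\infty P)$; and for every $\varepsilon>0$, with probability at least $1-\varepsilon$, the execution time on $P$ processors is $T_1/P+O(P(T_\infty+\lg(P/\varepsilon)))$. Precisely: there is an absolute constant $C>0$ such that for all $P\ge1$, all trees of serial tasks as above and all rules for resolving competition, $$\frac{T_1}{P}\le \mathbb E[T]\le \frac{T_1}{P}+C\,T_\infty P,$$ and for every $\varepsilon>0$, $$\Pr\Big[\frac{T_1}{P}\le T\le \frac{T_1}{P}+C\,P\big(T_\infty+\lg(P/\varepsilon)\big)\Big]\ge 1-\varepsilon .$$ -/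

import Mathlib

open MeasureTheory
open scoped ENNReal

namespace LocalizedWorkStealing

/-- A binary tree of work; the leaves are the serial tasks, labelled by their (remaining) sizes.
A processor holding a tree always works on the leftmost serial task of the tree. -/
inductive TaskTree : Type
  | leaf (size : ℕ) : TaskTree
  | node (left right : TaskTree) : TaskTree

namespace TaskTree

/-- All serial tasks have positive size. -/
def Pos : TaskTree → Prop
  | leaf s => 0 < s
  | node l r => l.Pos ∧ r.Pos

/-- The total size of the serial tasks. -/
def work : TaskTree → ℕ
  | leaf s => s
  | node l r => l.work + r.work

/-- The height of the tree (number of edges on a longest path from the root to a leaf). -/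
def height : TaskTree → ℕ
  | leaf _ => 0
  | node l r => max l.height r.height + 1

/-- The size of the largest serial task. -/
def maxTask : TaskTree → ℕ
  | leaf s => s
  | node l r => max l.maxTask r.maxTask

/-- One unit of time spent on the leftmost serial task. When that task is completed, it is removed,
and `none` says that the whole tree is completed. -/
def exec : TaskTree → Option TaskTree
  | leaf s => if s ≤ 1 then none else some (leaf (s - 1))
  | node l r =>
    match l.exec with
    | none => some r
    | some l' => some (node l' r)

/-- The branch at the root that can be stolen: the one that the processor is not working on. -/
def stealable : TaskTree → Option TaskTree
  | leaf _ => none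
  | node _ r => some r

/-- What remains when the stealable branch has been taken away. -/
def kept : TaskTree → TaskTree
  | leaf s => leaf s
  | node l _ => l

end TaskTree

/-- The work owned by the `P` processors: a tree of serial tasks for each processor, or `none` for a
processor which owns no serial task. -/
abbrev Input (P : ℕ) : Type := Fin P → Option TaskTree

/-- The work `T₁`: the total size of all serial tasks. -/
def totalWork {P : ℕ} (I : Input P) : ℕ :=
  ∑ i, (I i).elim 0 TaskTree.work

/-- The span `T_∞`: the height of the large tree, in which the roots of the `P` processors are
connected by a binary tree of height `⌈lg P⌉`, plus the size of the largest serial task. -/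
def span {P : ℕ} (I : Input P) : ℕ :=
  (Nat.clog 2 P + Finset.univ.sup fun i => (I i).elim 0 TaskTree.height) +
    Finset.univ.sup fun i => (I i).elim 0 TaskTree.maxTask

/-- The state of the computation between two timesteps. -/
structure Config (P : ℕ) where
  /-- The work that each processor currently has, together with the owner of that work;
  `none` means that the processor is free. -/
  held : Fin P → Option (Fin P × TaskTree)
  /-- For each owner, its list of the other processors that are working on its work. -/
  helpers : Fin P → Finset (Fin P)

/-- At the beginning every processor holds the work it owns, and all lists are empty. -/
def init {P : ℕ} (I : Input P) : Config P where
  held i := (I i).map fun t => (i, t)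
  helpers _ := ∅

/-- The targets chosen by the `P` processors in one timestep. -/
abbrev Choice (P : ℕ) : Type := Fin P → Fin P

namespace Config

variable {P : ℕ}

/-- A processor is free if it has no work. -/
def Free (c : Config P) (i : Fin P) : Prop := (c.held i).isNone = true

instance (c : Config P) : DecidablePred c.Free := fun _ => inferInstanceAs (Decidable (_ = _))

/-- All work is completed. -/
def Finished (c : Config P) : Prop := ∀ i, c.Free i

/-- The processors that still have work left to do. -/
def busy (c : Config P) : Finset (Fin P) := Finset.univ.filter fun q => ¬ c.Free q

/-- The set from which processor `i` draws its target, uniformly at random: a free processor steals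
back from the processors on its list if the list is nonempty, and otherwise makes a general steal
from a processor that has work left. A processor which does not steal "chooses" itself. -/
def targets (c : Config P) (i : Fin P) : Finset (Fin P) :=
  if c.Free i then
    if (c.helpers i).Nonempty then c.helpers i
    else if c.busy.Nonempty then c.busy
    else {i}
  else {i}

/-- The probability that the processors, which choose independently of each other, choose `v`. -/
noncomputable def choiceProb (c : Config P) (v : Choice P) : ℝ≥0∞ :=
  ∏ i, if v i ∈ c.targets i then ((c.targets i).card : ℝ≥0∞)⁻¹ else 0

/-- The branch that can be stolen from processor `q` together with its owner, if there is one. -/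
def loot (c : Config P) (q : Fin P) : Option (Fin P × TaskTree) :=
  (c.held q).bind fun w => w.2.stealable.map fun r => (w.1, r)

/-- The owner of the branch that can be stolen from processor `q`, if there is one. -/
def lootOwner (c : Config P) (q : Fin P) : Option (Fin P) := (c.loot q).map Prod.fst

/-- The processors which compete for the stealable branch of processor `q`. A processor which steals
back takes only work that it owns. -/
def contenders (c : Config P) (v : Choice P) (q : Fin P) : Finset (Fin P) :=
  Finset.univ.filter fun i => c.Free i ∧ v i = q ∧ (c.loot q).isSome = true ∧
    ((c.helpers i).Nonempty → c.lootOwner q = some i)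

/-- Processor `i` succeeds in stealing; `win q S` is the processor that succeeds when the processors
in `S` compete for the branch of processor `q`. -/
def Succeeds (c : Config P) (v : Choice P) (win : Fin P → Finset (Fin P) → Fin P)
    (i : Fin P) : Prop :=
  i ∈ c.contenders v (v i) ∧ win (v i) (c.contenders v (v i)) = i

instance (c : Config P) (v : Choice P) (win : Fin P → Finset (Fin P) → Fin P) :
    DecidablePred (c.Succeeds v win) := fun _ => inferInstanceAs (Decidable (_ ∧ _))

/-- Processor `o` has made a steal-back from a processor which has no branch owned by `o` to give
away. -/
def NothingLeft (c : Config P) (v : Choice P) (o : Fin P) : Prop :=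
  c.Free o ∧ (c.helpers o).Nonempty ∧ c.lootOwner (v o) ≠ some o

instance (c : Config P) (v : Choice P) : DecidablePred (c.NothingLeft v) :=
  fun _ => inferInstanceAs (Decidable (_ ∧ _ ∧ _))

/-- One timestep. Each processor that has work executes one unit of it, after its stealable branch
has been taken away if somebody competes for that branch. Each free processor makes one steal
attempt; it starts to work on a stolen branch in the next timestep. An owner removes from its list
the target of a steal-back which has nothing left for it, and a processor which has stolen work of
another owner is added to the list of that owner. -/
def step (c : Config P) (v : Choice P) (win : Fin P → Finset (Fin P) → Fin P) : Config P where
  held i :=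
    match c.held i with
    | some (o, t) =>
      ((if (c.contenders v i).Nonempty then t.kept else t).exec).map fun t' => (o, t')
    | none => if c.Succeeds v win i then c.loot (v i) else none
  helpers o :=
    ((c.helpers o).filter fun q => ¬ (c.NothingLeft v o ∧ q = v o)) ∪
      Finset.univ.filter fun i => i ≠ o ∧ c.Succeeds v win i ∧ c.lootOwner (v i) = some o

end Config

/-- A rule which decides who succeeds when several processors compete for the same branch. It may
depend on all choices made so far, including those of the current timestep. -/
abbrev Arbiter (P : ℕ) : Type := List (Choice P) → Fin P → Finset (Fin P) → Fin P

/-- The rule always selects one of the competing processors. -/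
def Arbiter.Valid {P : ℕ} (A : Arbiter P) : Prop :=
  ∀ h q S, S.Nonempty → A h q S ∈ S

/-- The state after `n` timesteps, if the choices in the timesteps are `x 0`, `x 1`, ... -/
def config {P : ℕ} (I : Input P) (A : Arbiter P) (x : ℕ → Choice P) : ℕ → Config P
  | 0 => init I
  | n + 1 => (config I A x n).step (x n) (A ((List.range (n + 1)).map x))

/-- The execution time: the number of timesteps until all work is completed. -/
noncomputable def runningTime {P : ℕ} (I : Input P) (A : Arbiter P) (x : ℕ → Choice P) : ℝ≥0∞ :=
  ⨅ (n : ℕ) (_ : (config I A x n).Finished), (n : ℝ≥0∞)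

/-- The random choices `X 0`, `X 1`, ... are those of the localized work-stealing algorithm: given
the past, the free processors choose independently of each other, each of them uniformly from the
set of its possible targets. -/
structure IsExecution {P : ℕ} (I : Input P) (A : Arbiter P) {Ω : Type*} [MeasurableSpace Ω]
    (μ : Measure Ω) (X : ℕ → Ω → Choice P) : Prop where
  measurable : ∀ n, Measurable (X n)
  law : ∀ (n : ℕ) (x : ℕ → Choice P),
    μ {ω | ∀ k < n + 1, X k ω = x k} =
      μ {ω | ∀ k < n, X k ω = x k} * (config I A x n).choiceProb (x n)

end LocalizedWorkStealing

/-! Give a tree of height `h` the potential `4 ^ h - 1`. A successful steal replaces it by two trees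
of smaller height, which at least halves its potential, and execution never raises it. Attempts are
divided into `P + 1` kinds: general steals, measured against the potential of all work, and for each
owner `o` its steal-backs, measured against the potential of the work of `o` alone. The lists
contain every processor with a stealable branch of foreign work (`Listed`), so one free processor
making an attempt of a kind targets each relevant tree with probability at least `1 / P`. The
expected potential thus drops by the factor `1 - 1 / (2 P)`, whatever the others and the arbiter do.
Hence `(1 + 1 / (4 P)) ^ attempts * (potential + 1)` is a supermartingale for each kind
(`sum_moment_le`), with initial value at most `P * 4 ^ height`.

Deterministically (`mul_le_of_not_finished`), the `P` processor steps of a timestep are paid for by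
executed work, by `P` if somebody makes a general steal, and by one for each steal-back. Attempts
made when the relevant potential is already zero are few: all work ends within the largest task
size, and each useless steal-back shortens a list of length at most `P`. A run that is too long
therefore has a kind with many attempts, and Markov's inequality for the sum of the `P + 1` moments
gives a tail that halves every `8 P` timesteps (`measure_not_finished_le`). Both upper bounds
follow; the lower bound holds because a timestep executes at most `P` units. -/

namespace LocalizedWorkStealing

/-! ### Trees: execution and loss of a branch. -/

namespace TaskTree

theorem Pos.maxTask_pos : ∀ {t : TaskTree}, t.Pos → 0 < t.maxTask
  | leaf _, h => h
  | node _ _, h => lt_max_of_lt_left (Pos.maxTask_pos h.1)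

theorem height_exec : ∀ {t t' : TaskTree}, t.exec = some t' → t'.height ≤ t.height
  | leaf s, t', h => by
    simp only [exec] at h
    split_ifs at h
    cases h
    simp [height]
  | node l r, t', h => by
    simp only [exec] at h
    split at h
    · cases h
      simp only [height]
      omega
    · rename_i l' hl
      cases h
      have := height_exec hl
      simp only [height]
      omega

theorem Pos.exec : ∀ {t t' : TaskTree}, t.Pos → t.exec = some t' → t'.Pos
  | leaf s, t', hp, h => by
    simp only [TaskTree.exec] at h
    split_ifs at h
    cases h
    simp only [Pos]
    omega
  | node l r, t', hp, h => by
    simp only [TaskTree.exec] at h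
    split at h
    · cases h
      exact hp.2
    · rename_i l' hl
      cases h
      exact ⟨Pos.exec hp.1 hl, hp.2⟩

theorem maxTask_exec : ∀ {t t' : TaskTree}, t.exec = some t' → t'.maxTask ≤ t.maxTask
  | leaf s, t', h => by
    simp only [exec] at h
    split_ifs at h
    cases h
    simp [maxTask]
  | node l r, t', h => by
    simp only [exec] at h
    split at h
    · cases h
      simp only [maxTask]
      omega
    · rename_i l' hl
      cases h
      have := maxTask_exec hl
      simp only [maxTask]
      omega

theorem Pos.work_exec : ∀ {t : TaskTree}, t.Pos → t.exec.elim 0 work + 1 = t.work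
  | leaf s, hp => by
    simp only [Pos] at hp
    simp only [TaskTree.exec]
    split_ifs
    · simp only [Option.elim, work]
      omega
    · simp only [Option.elim, work]
      omega
  | node l r, hp => by
    have := Pos.work_exec hp.1
    simp only [TaskTree.exec]
    split
    · rename_i hl
      simp only [hl, Option.elim] at this
      simp only [Option.elim, work]
      omega
    · rename_i l' hl
      simp only [hl, Option.elim] at this
      simp only [Option.elim, work]
      omega

theorem Pos.kept {t : TaskTree} (h : t.Pos) : t.kept.Pos := by
  cases t with
  | leaf s => exact h
  | node l r => exact h.1

theorem maxTask_kept (t : TaskTree) : t.kept.maxTask ≤ t.maxTask := by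
  cases t with
  | leaf s => exact le_rfl
  | node l r => exact le_max_left _ _

theorem height_kept (t : TaskTree) : t.kept.height ≤ t.height := by
  cases t with
  | leaf s => exact le_rfl
  | node l r =>
    simp only [height, TaskTree.kept]
    omega

end TaskTree

/-! ### A single timestep with fixed choices. -/

namespace Config

variable {P : ℕ}

/-- What processor `q` holds after a timestep in which it does not steal. -/
def advance (c : Config P) (v : Choice P) (q : Fin P) : Option (Fin P × TaskTree) :=
  (c.held q).bind fun w =>
    ((if (c.contenders v q).Nonempty then w.2.kept else w.2).exec).map fun t => (w.1, t)

theorem Succeeds.free {c : Config P} {v : Choice P} {win : Fin P → Finset (Fin P) → Fin P}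
    {i : Fin P} (h : c.Succeeds v win i) : c.Free i :=
  (Finset.mem_filter.1 h.1).2.1

theorem Free.held_eq {c : Config P} {i : Fin P} (h : c.Free i) : c.held i = none :=
  Option.isNone_iff_eq_none.1 h

theorem loot_isSome_of_contenders {c : Config P} {v : Choice P} {q : Fin P}
    (h : (c.contenders v q).Nonempty) : (c.loot q).isSome = true := by
  obtain ⟨i, hi⟩ := h
  exact (Finset.mem_filter.1 hi).2.2.2.1

theorem step_held (c : Config P) (v : Choice P) (win : Fin P → Finset (Fin P) → Fin P)
    (i : Fin P) :
    (c.step v win).held i = c.advance v i ∨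
      c.Succeeds v win i ∧ (c.step v win).held i = c.loot (v i) := by
  by_cases hs : c.Succeeds v win i
  · right
    refine ⟨hs, ?_⟩
    simp [step, hs.free.held_eq, hs]
  · left
    cases hh : c.held i with
    | none => simp [step, advance, hh, hs]
    | some w => simp [step, advance, hh]

/-- What is held after a timestep, added up: every stealable branch for which there is competition
goes to exactly one processor. -/
theorem sum_step_held (c : Config P) (v : Choice P) (win : Fin P → Finset (Fin P) → Fin P)
    (hwin : ∀ q S, S.Nonempty → win q S ∈ S) (g : Option (Fin P × TaskTree) → ℕ)
    (g0 : g none = 0) :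
    ∑ i, g ((c.step v win).held i) =
      ∑ q, (g (c.advance v q) + if (c.contenders v q).Nonempty then g (c.loot q) else 0) := by
  have h1 : ∀ i, g ((c.step v win).held i) =
      g (c.advance v i) + if c.Succeeds v win i then g (c.loot (v i)) else 0 := by
    intro i
    cases hh : c.held i with
    | none =>
      by_cases hs : c.Succeeds v win i <;> simp [step, advance, hh, hs, g0]
    | some w =>
      have hs : ¬ c.Succeeds v win i := fun hs => by simp [hs.free.held_eq] at hh
      simp [step, advance, hh, hs]
  rw [Finset.sum_congr rfl fun i _ => h1 i, Finset.sum_add_distrib, Finset.sum_add_distrib]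
  congr 1
  -- Summing over the target as well turns the sum over stealers into one over victims, where only
  -- the winner contributes.
  have h2 : ∀ i, (if c.Succeeds v win i then g (c.loot (v i)) else 0) =
      ∑ q, if v i = q then (if c.Succeeds v win i then g (c.loot (v i)) else 0) else 0 := by
    intro i
    simp
  rw [Finset.sum_congr rfl fun i _ => h2 i, Finset.sum_comm]
  refine Finset.sum_congr rfl fun q _ => ?_
  split_ifs with hne
  · have hw := hwin q _ hne
    have hv : v (win q (c.contenders v q)) = q := (Finset.mem_filter.1 hw).2.2.1
    rw [Finset.sum_eq_single (win q (c.contenders v q))]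
    · have : c.Succeeds v win (win q (c.contenders v q)) := by
        refine ⟨?_, ?_⟩ <;> simp only [hv]
        exact hw
      simp [hv, this]
    · intro i _ hi
      split_ifs with h3 h4
      · subst h3
        exact absurd h4.2.symm hi
      · rfl
      · rfl
    · simp
  · refine Finset.sum_eq_zero fun i _ => ?_
    split_ifs with h3 h4
    · subst h3
      exact absurd ⟨i, h4.1⟩ hne
    · rfl
    · rfl

theorem advance_eq_some {c : Config P} {v : Choice P} {q o : Fin P} {t' : TaskTree}
    (h : c.advance v q = some (o, t')) :
    ∃ t, c.held q = some (o, t) ∧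
      (if (c.contenders v q).Nonempty then t.kept else t).exec = some t' := by
  cases hh : c.held q with
  | none => simp [advance, hh] at h
  | some w =>
    obtain ⟨o', t⟩ := w
    simp only [advance, hh, Option.bind_some, Option.map_eq_some_iff, Prod.mk.injEq] at h
    obtain ⟨a, ha, rfl, rfl⟩ := h
    exact ⟨t, rfl, ha⟩

theorem loot_eq_some {c : Config P} {q o : Fin P} {r : TaskTree}
    (h : c.loot q = some (o, r)) : ∃ l, c.held q = some (o, .node l r) := by
  cases hh : c.held q with
  | none => simp [loot, hh] at h
  | some w =>
    obtain ⟨o', t⟩ := w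
    cases t with
    | leaf s => simp [loot, hh, TaskTree.stealable] at h
    | node l r' =>
      simp only [loot, hh, Option.bind_some, TaskTree.stealable, Option.map_some, Option.some.injEq,
        Prod.mk.injEq] at h
      obtain ⟨rfl, rfl⟩ := h
      exact ⟨l, rfl⟩

/-- A property of trees that passes to remainders and to branches is preserved by a timestep. -/
theorem step_held_forall {c : Config P} {v : Choice P} {win : Fin P → Finset (Fin P) → Fin P}
    {p : TaskTree → Prop} (hexec : ∀ t t', p t → t.exec = some t' → p t')
    (hkept : ∀ t, p t → p t.kept) (hright : ∀ l r, p (.node l r) → p r)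
    (h : ∀ q o t, c.held q = some (o, t) → p t) :
    ∀ q o t, (c.step v win).held q = some (o, t) → p t := by
  intro q o t' ht'
  rcases step_held c v win q with h1 | ⟨_, h1⟩
  · rw [h1] at ht'
    obtain ⟨t, ht, he⟩ := advance_eq_some ht'
    refine hexec _ _ ?_ he
    split_ifs
    · exact hkept _ (h _ _ _ ht)
    · exact h _ _ _ ht
  · rw [h1] at ht'
    obtain ⟨l, hl⟩ := loot_eq_some ht'
    exact hright _ _ (h _ _ _ hl)

/-- The work which is left. -/
def work (c : Config P) : ℕ := ∑ q, (c.held q).elim 0 fun w => w.2.work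

/-- A steal moves a branch without loss, and each busy processor executes exactly one unit since
sizes are positive. -/
theorem work_step {c : Config P} {v : Choice P} {win : Fin P → Finset (Fin P) → Fin P}
    (hwin : ∀ q S, S.Nonempty → win q S ∈ S)
    (h : ∀ q o t, c.held q = some (o, t) → t.Pos) :
    (c.step v win).work + c.busy.card = c.work := by
  have hb : c.busy.card = ∑ q, if c.Free q then 0 else 1 := by
    rw [busy, Finset.card_filter]
    refine Finset.sum_congr rfl fun q _ => ?_
    split_ifs <;> simp_all
  rw [work, sum_step_held c v win hwin (fun w => w.elim 0 fun w => w.2.work) rfl, hb,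
    ← Finset.sum_add_distrib, work]
  refine Finset.sum_congr rfl fun q _ => ?_
  cases hh : c.held q with
  | none =>
    have hl : c.loot q = none := by simp [loot, hh]
    simp [advance, hh, Free, hl]
  | some w =>
    obtain ⟨o, t⟩ := w
    have hp := h q o t hh
    have key : ∀ s : TaskTree, s.Pos →
        ((s.exec.map fun t => (o, t)).elim 0 fun w : Fin P × TaskTree => w.2.work) + 1 =
          s.work := by
      intro s hs
      have := hs.work_exec
      cases he : s.exec <;> simpa [he] using this
    have hf : ¬ c.Free q := by simp [Free, hh]
    simp only [advance, hh, Option.bind_some, hf, if_false]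
    split_ifs with hne
    · cases t with
      | leaf s =>
        have := loot_isSome_of_contenders hne
        simp [loot, hh, TaskTree.stealable] at this
      | node l r =>
        have := key l hp.1
        simp only [TaskTree.kept, loot, hh, TaskTree.stealable, Option.bind_some, Option.map_some,
          Option.elim, TaskTree.work] at this ⊢
        omega
    · have := key t hp
      simpa using this

theorem Finished.step {c : Config P} (h : c.Finished) (v : Choice P)
    (win : Fin P → Finset (Fin P) → Fin P) : (c.step v win).Finished := by
  intro i
  rw [Free, Option.isNone_iff_eq_none]
  rcases step_held c v win i with h1 | ⟨_, h1⟩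
  · rw [h1, advance, (h i).held_eq, Option.bind_none]
  · rw [h1, loot, (h _).held_eq, Option.bind_none]

theorem Finished.work_eq_zero {c : Config P} (h : c.Finished) : c.work = 0 :=
  Finset.sum_eq_zero fun q _ => by simp [(h q).held_eq]

/-! ### The potential, the lists and the final serial phase. -/

/-- The potential of what a processor holds, if only the work of the owners in `S` counts. -/
def heldPotential (S : Finset (Fin P)) (w : Option (Fin P × TaskTree)) : ℕ :=
  w.elim 0 fun w => if w.1 ∈ S then 4 ^ w.2.height - 1 else 0

/-- The potential of the work of the owners in `S`. -/
def potential (S : Finset (Fin P)) (c : Config P) : ℕ := ∑ q, heldPotential S (c.held q)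

/-- Subtracting 1 makes a leaf weightless, so that zero potential means exactly that nothing can be
stolen. -/
theorem heldPotential_pos {S : Finset (Fin P)} {w : Option (Fin P × TaskTree)} :
    0 < heldPotential S w ↔ ∃ o t, w = some (o, t) ∧ o ∈ S ∧ 0 < t.height := by
  cases w with
  | none => simp [heldPotential]
  | some w =>
    obtain ⟨o, t⟩ := w
    simp only [heldPotential, Option.elim]
    split_ifs with h
    · constructor
      · intro h4
        refine ⟨o, t, rfl, h, Nat.pos_of_ne_zero fun h0 => ?_⟩
        simp [h0] at h4
      · rintro ⟨o', t', he, -, ht⟩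
        cases he
        have := Nat.one_lt_pow ht.ne' (by norm_num : 1 < 4)
        omega
    · constructor
      · simp
      · rintro ⟨o', t', he, h', -⟩
        cases he
        exact absurd h' h

/-- With children of height at most `h`, the two parts weigh at most `2 * (4 ^ h - 1)`, less than
half of `4 ^ (h + 1) - 1`. The factor 2 avoids division in `ℕ`. -/
theorem heldPotential_advance (S : Finset (Fin P)) (c : Config P) (v : Choice P) (q : Fin P) :
    2 * (heldPotential S (c.advance v q) +
        if (c.contenders v q).Nonempty then heldPotential S (c.loot q) else 0) +
      (if (c.contenders v q).Nonempty then heldPotential S (c.held q) else 0) ≤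
      2 * heldPotential S (c.held q) := by
  cases hh : c.held q with
  | none =>
    have hl : c.loot q = none := by simp [loot, hh]
    simp [advance, hh, hl, heldPotential]
  | some w =>
    obtain ⟨o, t⟩ := w
    have key : ∀ s : TaskTree, heldPotential S (s.exec.map fun t => (o, t)) ≤
        heldPotential S (some (o, s)) := by
      intro s
      cases he : s.exec with
      | none => simp [heldPotential]
      | some s' =>
        have := Nat.pow_le_pow_right (by norm_num : 0 < 4) (TaskTree.height_exec he)
        simp only [heldPotential, Option.map_some, Option.elim]
        split_ifs <;> omega
    simp only [advance, hh, Option.bind_some]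
    split_ifs with hne
    · cases t with
      | leaf s =>
        have := loot_isSome_of_contenders hne
        simp [loot, hh, TaskTree.stealable] at this
      | node l r =>
        have := key l
        simp only [TaskTree.kept, loot, hh, TaskTree.stealable, Option.bind_some, Option.map_some]
        by_cases ho : o ∈ S
        · have h1 := Nat.pow_le_pow_right (by norm_num : 0 < 4) (le_max_left l.height r.height)
          have h2 := Nat.pow_le_pow_right (by norm_num : 0 < 4) (le_max_right l.height r.height)
          have h3 := Nat.pow_pos (n := l.height) (by norm_num : 0 < 4)
          have h4 := Nat.pow_pos (n := r.height) (by norm_num : 0 < 4)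
          simp only [heldPotential, Option.elim, ho, if_true, TaskTree.height, pow_succ] at this ⊢
          omega
        · simp only [heldPotential, Option.elim, ho, if_false] at this ⊢
          omega
    · have := key t
      omega

/-- In a timestep, the potential of every tree that is the target of an attempt is halved. -/
theorem potential_step (S : Finset (Fin P)) (c : Config P) (v : Choice P)
    {win : Fin P → Finset (Fin P) → Fin P} (hwin : ∀ q S, S.Nonempty → win q S ∈ S) :
    2 * potential S (c.step v win) +
      (∑ q, if (c.contenders v q).Nonempty then heldPotential S (c.held q) else 0) ≤
      2 * potential S c := by
  rw [potential, sum_step_held c v win hwin (heldPotential S) rfl, potential, Finset.mul_sum,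
    Finset.mul_sum, ← Finset.sum_add_distrib]
  exact Finset.sum_le_sum fun q _ => heldPotential_advance S c v q

theorem lootOwner_eq_some {c : Config P} {q o : Fin P} :
    c.lootOwner q = some o ↔ ∃ t, c.held q = some (o, t) ∧ 0 < t.height := by
  cases hh : c.held q with
  | none => simp [lootOwner, loot, hh]
  | some w =>
    obtain ⟨o', t⟩ := w
    cases t with
    | leaf s =>
      simp only [lootOwner, loot, hh, TaskTree.stealable]
      simp only [Option.bind_some, Option.map_none, reduceCtorEq, false_iff, not_exists]
      rintro t ⟨he, ht⟩
      cases he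
      simp [TaskTree.height] at ht
    | node l r =>
      simp only [lootOwner, loot, hh, TaskTree.stealable]
      simp only [Option.bind_some, Option.map_some, Option.some.injEq]
      constructor
      · rintro rfl
        exact ⟨_, rfl, by simp [TaskTree.height]⟩
      · rintro ⟨t, he, -⟩
        cases he
        rfl

/-- Every processor which has a branch of the work of another processor to give away is on the list
of the owner. -/
def Listed (c : Config P) : Prop := ∀ q o, q ≠ o → c.lootOwner q = some o → q ∈ c.helpers o

/-- A processor leaves the list of `o` only when it has no branch of `o` to give. Execution cannot
create one, and acquiring one by stealing puts it on the list again. -/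
theorem Listed.step {c : Config P} (h : c.Listed) (v : Choice P)
    (win : Fin P → Finset (Fin P) → Fin P) : (c.step v win).Listed := by
  intro q o hqo hq
  obtain ⟨t', ht', h0⟩ := lootOwner_eq_some.1 hq
  rw [Config.step, Finset.mem_union]
  rcases step_held c v win q with h1 | ⟨hs, h1⟩
  · left
    rw [h1] at ht'
    obtain ⟨t, ht, he⟩ := advance_eq_some ht'
    have h2 : 0 < t.height := by
      refine h0.trans_le ((TaskTree.height_exec he).trans ?_)
      split_ifs
      · exact TaskTree.height_kept t
      · exact le_rfl
    have h3 : c.lootOwner q = some o := lootOwner_eq_some.2 ⟨t, ht, h2⟩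
    refine Finset.mem_filter.2 ⟨h q o hqo h3, ?_⟩
    rintro ⟨hn, rfl⟩
    exact hn.2.2 h3
  · right
    rw [h1] at ht'
    refine Finset.mem_filter.2 ⟨Finset.mem_univ _, hqo, hs, ?_⟩
    simp [lootOwner, ht']

theorem potential_eq_zero_iff {S : Finset (Fin P)} {c : Config P} :
    potential S c = 0 ↔ ∀ q o, o ∈ S → c.lootOwner q ≠ some o := by
  rw [potential, Finset.sum_eq_zero_iff]
  constructor
  · intro h q o ho hq
    obtain ⟨t, ht, h0⟩ := lootOwner_eq_some.1 hq
    have := heldPotential_pos.2 ⟨o, t, ht, ho, h0⟩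
    have := h q (Finset.mem_univ _)
    omega
  · intro h q _
    by_contra h0
    obtain ⟨o, t, ht, ho, h1⟩ := heldPotential_pos.1 (Nat.pos_of_ne_zero h0)
    exact h q o ho (lootOwner_eq_some.2 ⟨t, ht, h1⟩)

/-- If the owner `o` steals back although nobody has a branch of its work to give away, its list
gets shorter. -/
theorem card_helpers_step_lt {c : Config P} {v : Choice P}
    {win : Fin P → Finset (Fin P) → Fin P} {o : Fin P} (h0 : potential {o} c = 0)
    (hf : c.Free o) (hv : v o ∈ c.helpers o) :
    ((c.step v win).helpers o).card < (c.helpers o).card := by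
  -- No branch of `o` can be stolen, so nobody joins its list in this timestep.
  have h1 : ∀ q, c.lootOwner q ≠ some o := fun q =>
    potential_eq_zero_iff.1 h0 q o (Finset.mem_singleton_self o)
  have hn : c.NothingLeft v o := ⟨hf, ⟨_, hv⟩, h1 _⟩
  refine Finset.card_lt_card (Finset.ssubset_iff_subset_ne.2 ⟨?_, fun he => ?_⟩)
  · intro q hq
    simpa [step, h1] using And.left (by simpa [step, h1] using hq)
  · rw [← he] at hv
    simp [step, h1, hn] at hv

theorem card_helpers_step_le {c : Config P} {v : Choice P}
    {win : Fin P → Finset (Fin P) → Fin P} {o : Fin P} (h0 : potential {o} c = 0) :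
    ((c.step v win).helpers o).card ≤ (c.helpers o).card := by
  have h1 : ∀ q, c.lootOwner q ≠ some o := fun q =>
    potential_eq_zero_iff.1 h0 q o (Finset.mem_singleton_self o)
  refine Finset.card_le_card fun q hq => ?_
  simpa [step, h1] using And.left (by simpa [step, h1] using hq)

/-- All trees that are left are serial tasks of size at most `s`. -/
def Serial (c : Config P) (s : ℕ) : Prop :=
  ∀ q o t, c.held q = some (o, t) → ∃ k ≤ s, t = .leaf k

theorem Serial.loot_eq_none {c : Config P} {s : ℕ} (h : c.Serial s) (q : Fin P) :
    c.loot q = none := by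
  cases hl : c.loot q with
  | none => rfl
  | some w =>
    obtain ⟨l, hl⟩ := loot_eq_some (o := w.1) (r := w.2) hl
    obtain ⟨k, -, hk⟩ := h _ _ _ hl
    cases hk

theorem Serial.step {c : Config P} {s : ℕ} (h : c.Serial (s + 1)) (v : Choice P)
    (win : Fin P → Finset (Fin P) → Fin P) : (c.step v win).Serial s := by
  intro q o t' ht'
  rcases step_held c v win q with h1 | ⟨hs, h1⟩
  · rw [h1] at ht'
    obtain ⟨t, ht, he⟩ := advance_eq_some ht'
    obtain ⟨k, hk, rfl⟩ := h _ _ _ ht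
    simp only [TaskTree.kept, ite_self, TaskTree.exec] at he
    split_ifs at he
    cases he
    exact ⟨_, by omega, rfl⟩
  · rw [h1, h.loot_eq_none] at ht'
    cases ht'

theorem Serial.finished_step {c : Config P} (h : c.Serial 1) (v : Choice P)
    (win : Fin P → Finset (Fin P) → Fin P) : (c.step v win).Finished := by
  intro q
  rw [Free, Option.isNone_iff_eq_none]
  rcases step_held c v win q with h1 | ⟨hs, h1⟩
  · rw [h1]
    by_contra hne
    obtain ⟨⟨o, t'⟩, ht'⟩ := Option.ne_none_iff_exists'.1 hne
    obtain ⟨t, ht, he⟩ := advance_eq_some ht'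
    obtain ⟨k, hk, rfl⟩ := h _ _ _ ht
    simp [TaskTree.kept, TaskTree.exec, hk] at he
  · rw [h1, h.loot_eq_none]

end Config

end LocalizedWorkStealing

/-! ### Accounting of processor steps along a run. -/

namespace LocalizedWorkStealing

namespace Config

variable {P : ℕ}

/-- Some processor makes a general steal (for `none`), or the owner `o` steals back
(for `some o`). -/
def Active : Option (Fin P) → Config P → Prop
  | none, c => ∃ i, c.Free i ∧ ¬ (c.helpers i).Nonempty
  | some o, c => c.Free o ∧ (c.helpers o).Nonempty

/-- The owners whose work the steal attempts described by `Active` can hit. -/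
def group : Option (Fin P) → Finset (Fin P)
  | none => Finset.univ
  | some o => {o}

open Classical in
-- If somebody makes a general steal, the whole timestep is charged to it. Otherwise every free
-- processor has a nonempty list and is charged to its own steal-back.
theorem card_busy_add_le (c : Config P) :
    P ≤ c.busy.card + (P * (if Active none c then 1 else 0) +
      ∑ o, if Active (some o) c then 1 else 0) := by
  have h1 : c.busy.card + (Finset.univ.filter fun i => c.Free i).card = P := by
    have := Finset.card_filter_add_card_filter_not (s := Finset.univ) (fun i => c.Free i)
    rw [Finset.card_univ, Fintype.card_fin] at this
    rw [busy, add_comm]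
    exact this
  have h2 : (Finset.univ.filter fun i => c.Free i).card ≤
      P * (if Active none c then 1 else 0) + ∑ o, if Active (some o) c then 1 else 0 := by
    split_ifs with hg
    · refine le_add_right ?_
      simpa using Finset.card_filter_le (Finset.univ : Finset (Fin P)) fun i => c.Free i
    · rw [mul_zero, zero_add, Finset.card_filter]
      refine Finset.sum_le_sum fun i _ => ?_
      by_cases hf : c.Free i
      · have : (c.helpers i).Nonempty := by
          by_contra hne
          exact hg ⟨i, hf, hne⟩
        rw [if_pos hf, if_pos (show Active (some i) c from ⟨hf, this⟩)]
      · simp [hf]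
  omega

end Config

open Config

variable {P : ℕ} {I : Input P} {A : Arbiter P}

theorem config_congr {x y : ℕ → Choice P} : ∀ {n : ℕ}, (∀ k < n, x k = y k) →
    config I A x n = config I A y n
  | 0, _ => rfl
  | n + 1, h => by
    have h1 : (List.range (n + 1)).map x = (List.range (n + 1)).map y :=
      List.map_congr_left fun k hk => h k (List.mem_range.1 hk)
    rw [config, config, config_congr fun k hk => h k (hk.trans n.lt_succ_self), h1,
      h n n.lt_succ_self]

theorem config_held_forall {p : TaskTree → Prop} (hexec : ∀ t t', p t → t.exec = some t' → p t')
    (hkept : ∀ t, p t → p t.kept) (hright : ∀ l r, p (.node l r) → p r)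
    (h : ∀ i, ∀ t ∈ I i, p t) (x : ℕ → Choice P) :
    ∀ n q o t, (config I A x n).held q = some (o, t) → p t
  | 0, q, o, t, ht => by
    simp only [config, init, Option.map_eq_some_iff, Prod.mk.injEq] at ht
    obtain ⟨a, ha, -, rfl⟩ := ht
    exact h q a ha
  | n + 1, q, o, t, ht =>
    step_held_forall hexec hkept hright (config_held_forall hexec hkept hright h x n) q o t ht

theorem config_pos (h : ∀ i, ∀ t ∈ I i, t.Pos) (x : ℕ → Choice P) (n : ℕ) (q o : Fin P)
    (t : TaskTree) : (config I A x n).held q = some (o, t) → t.Pos :=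
  config_held_forall (fun _ _ h1 h2 => h1.exec h2) (fun _ h1 => h1.kept) (fun _ _ h1 => h1.2) h
    x n q o t

/-- The size of the largest serial task. -/
def inputMaxTask (I : Input P) : ℕ := Finset.univ.sup fun i => (I i).elim 0 TaskTree.maxTask

/-- The largest height of the trees of the processors. -/
def inputHeight (I : Input P) : ℕ := Finset.univ.sup fun i => (I i).elim 0 TaskTree.height

theorem config_maxTask_le (x : ℕ → Choice P) (n : ℕ) (q o : Fin P) (t : TaskTree) :
    (config I A x n).held q = some (o, t) → t.maxTask ≤ inputMaxTask I := by
  refine config_held_forall (p := fun t => t.maxTask ≤ inputMaxTask I)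
    (fun _ _ h1 h2 => (TaskTree.maxTask_exec h2).trans h1)
    (fun _ h1 => (TaskTree.maxTask_kept _).trans h1) (fun _ _ h1 => (le_max_right _ _).trans h1)
    ?_ x n q o t
  intro i t ht
  have := Finset.le_sup (f := fun i => (I i).elim 0 TaskTree.maxTask) (Finset.mem_univ i)
  rw [Option.mem_def] at ht
  simpa [ht, inputMaxTask] using this

theorem config_listed (x : ℕ → Choice P) : ∀ n, (config I A x n).Listed
  | 0 => by
    intro q o hqo hq
    obtain ⟨t, ht, -⟩ := lootOwner_eq_some.1 hq
    simp only [config, init, Option.map_eq_some_iff, Prod.mk.injEq] at ht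
    obtain ⟨a, -, h, -⟩ := ht
    exact absurd h hqo
  | n + 1 => (config_listed x n).step _ _

theorem finished_mono {x : ℕ → Choice P} {k n : ℕ} (hkn : k ≤ n)
    (h : (config I A x k).Finished) : (config I A x n).Finished := by
  induction n, hkn using Nat.le_induction with
  | base => exact h
  | succ n _ ih => exact ih.step _ _

theorem work_config_add (hI : ∀ i, ∀ t ∈ I i, t.Pos) (hA : A.Valid) (x : ℕ → Choice P) (n : ℕ) :
    (config I A x n).work + ∑ k ∈ Finset.range n, (config I A x k).busy.card = totalWork I := by
  induction n with
  | zero =>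
    simp only [config, init, Config.work, Finset.range_zero, Finset.sum_empty, add_zero, totalWork]
    refine Finset.sum_congr rfl fun i _ => ?_
    cases I i <;> rfl
  | succ n ih =>
    have := work_step (v := x n) (hA ((List.range (n + 1)).map x)) (config_pos (A := A) hI x n)
    rw [Finset.sum_range_succ, ← ih, ← this, config]
    ring

theorem potential_config_succ_le (hA : A.Valid) (S : Finset (Fin P)) (x : ℕ → Choice P) (n : ℕ) :
    potential S (config I A x (n + 1)) ≤ potential S (config I A x n) := by
  have := potential_step S (config I A x n) (x n) (hA ((List.range (n + 1)).map x))
  rw [config]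
  omega

theorem finished_of_serial {x : ℕ → Choice P} : ∀ {s k : ℕ}, (config I A x k).Serial (s + 1) →
    (config I A x (k + (s + 1))).Finished
  | 0, _, h => h.finished_step _ _
  | s + 1, k, h => by
    have h1 : (config I A x (k + 1)).Serial (s + 1) := h.step _ _
    have := finished_of_serial h1
    rwa [show k + (s + 1 + 1) = k + 1 + (s + 1) by omega]

/-- Only leaves are left and nothing can be stolen, so each processor just finishes its current
task. The extra 1 spares a separate case for maximal size 0. -/
theorem finished_of_potential_eq_zero {x : ℕ → Choice P} {k : ℕ}
    (h : potential Finset.univ (config I A x k) = 0) :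
    (config I A x (k + (inputMaxTask I + 1))).Finished := by
  refine finished_of_serial fun q o t ht => ?_
  have h1 := config_maxTask_le x k q o t ht
  cases t with
  | leaf s => exact ⟨s, h1.trans (Nat.le_succ _), rfl⟩
  | node l r =>
    refine absurd (lootOwner_eq_some.2 ⟨_, ht, ?_⟩)
      (potential_eq_zero_iff.1 h q o (Finset.mem_univ o))
    simp [TaskTree.height]

/-- The choices made up to infinity are possible: whoever steals back has a target on its list. -/
def Legal (I : Input P) (A : Arbiter P) (x : ℕ → Choice P) : Prop :=
  ∀ n o, Active (some o) (config I A x n) → x n o ∈ (config I A x n).helpers o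

open Classical in
/-- The number of timesteps in which there is an attempt of the kind `j` while there still is
something to steal. -/
noncomputable def attempts (I : Input P) (A : Arbiter P) (j : Option (Fin P)) (x : ℕ → Choice P)
    (n : ℕ) : ℕ :=
  ∑ k ∈ Finset.range n,
    if Active j (config I A x k) ∧ 0 < potential (group j) (config I A x k) then 1 else 0

open Classical in
theorem sum_active_none_le {x : ℕ → Choice P} {n : ℕ} (hn : ¬ (config I A x n).Finished) :
    ∑ k ∈ Finset.range n, (if Active none (config I A x k) then 1 else 0) ≤
      attempts I A none x n + inputMaxTask I := by
  have h1 : ∑ k ∈ Finset.range n,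
      (if potential Finset.univ (config I A x k) = 0 then 1 else 0) ≤ inputMaxTask I := by
    rw [← Finset.card_filter]
    calc _ ≤ (Finset.Ico (n - inputMaxTask I) n).card := by
          refine Finset.card_le_card fun k hk => ?_
          rw [Finset.mem_filter, Finset.mem_range] at hk
          refine Finset.mem_Ico.2 ⟨?_, hk.1⟩
          by_contra hlt
          -- A timestep of zero potential before `n - inputMaxTask I` would force completion by time
          -- `n`.
          exact hn (finished_mono (by omega) (finished_of_potential_eq_zero hk.2))
      _ ≤ _ := by
          rw [Nat.card_Ico]
          omega
  refine le_trans ?_ (Nat.add_le_add_left h1 _)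
  rw [attempts, ← Finset.sum_add_distrib]
  refine Finset.sum_le_sum fun k _ => ?_
  rcases Nat.eq_zero_or_pos (potential Finset.univ (config I A x k)) with h | h
  · simp only [h, if_true]
    split_ifs <;> omega
  · have h' : 0 < potential (group none) (config I A x k) := h
    simp only [h', and_true]
    omega

open Classical in
theorem sum_active_some_le (hA : A.Valid) {x : ℕ → Choice P} (hx : Legal I A x) (o : Fin P)
    (n : ℕ) :
    ∑ k ∈ Finset.range n, (if Active (some o) (config I A x k) then 1 else 0) ≤
      attempts I A (some o) x n + P := by
  set f : ℕ → ℕ := fun k => if Active (some o) (config I A x k) ∧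
    potential {o} (config I A x k) = 0 then 1 else 0 with hf
  -- While work of `o` can be stolen, the count of useless steal-backs is 0. Afterwards the list
  -- cannot grow and each useless steal-back shortens it, so count plus list length stays at most
  -- `P`.
  have h1 : ∀ n, ∑ k ∈ Finset.range n, f k ≤ P ∧
      (0 < potential {o} (config I A x n) → ∑ k ∈ Finset.range n, f k = 0) ∧
      (∑ k ∈ Finset.range n, f k) + ((config I A x n).helpers o).card ≤ P := by
    intro n
    have hcard : ∀ n, ((config I A x n).helpers o).card ≤ P := fun n => by
      simpa using Finset.card_le_univ ((config I A x n).helpers o)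
    induction n with
    | zero => simpa using hcard 0
    | succ n ih =>
      obtain ⟨ih1, ih2, ih3⟩ := ih
      rcases Nat.eq_zero_or_pos (potential {o} (config I A x n)) with h0 | h0
      · have h0' : potential {o} (config I A x (n + 1)) = 0 :=
          Nat.eq_zero_of_le_zero (h0 ▸ potential_config_succ_le hA {o} x n)
        have key : f n + ((config I A x (n + 1)).helpers o).card ≤
            ((config I A x n).helpers o).card := by
          simp only [hf, h0, and_true]
          split_ifs with ha
          · have := card_helpers_step_lt (win := A ((List.range (n + 1)).map x)) h0 ha.1
              (hx n o ha)
            rw [config]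
            omega
          · rw [zero_add]
            exact card_helpers_step_le h0
        rw [Finset.sum_range_succ]
        omega
      · have hfn : f n = 0 := by
          simp only [hf]
          rw [if_neg]
          omega
        have := hcard (n + 1)
        rw [Finset.sum_range_succ, ih2 h0, hfn]
        simpa using this
  refine le_trans ?_ (Nat.add_le_add_left (h1 n).1 _)
  rw [attempts, ← Finset.sum_add_distrib]
  refine Finset.sum_le_sum fun k _ => ?_
  rcases Nat.eq_zero_or_pos (potential {o} (config I A x k)) with h | h
  · simp only [hf, h, and_true]
    omega
  · have h' : 0 < potential (group (some o)) (config I A x k) := h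
    simp only [h', and_true]
    omega

/-- As long as there is work left, the processor steps are accounted for by work and by steal
attempts. -/
theorem mul_le_of_not_finished (hI : ∀ i, ∀ t ∈ I i, t.Pos) (hA : A.Valid) {x : ℕ → Choice P}
    (hx : Legal I A x) {n : ℕ} (hn : ¬ (config I A x n).Finished) :
    n * P ≤ totalWork I + (P * (attempts I A none x n + inputMaxTask I) +
      ∑ o, (attempts I A (some o) x n + P)) := by
  classical
  calc n * P = ∑ k ∈ Finset.range n, P := by simp
    _ ≤ ∑ k ∈ Finset.range n, ((config I A x k).busy.card +
        (P * (if Active none (config I A x k) then 1 else 0) +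
          ∑ o, if Active (some o) (config I A x k) then 1 else 0)) :=
      Finset.sum_le_sum fun k _ => card_busy_add_le _
    _ = ∑ k ∈ Finset.range n, (config I A x k).busy.card +
        (P * ∑ k ∈ Finset.range n, (if Active none (config I A x k) then 1 else 0) +
          ∑ o, ∑ k ∈ Finset.range n, if Active (some o) (config I A x k) then 1 else 0) := by
      rw [Finset.sum_add_distrib, Finset.sum_add_distrib, Finset.mul_sum]
      congr 2
      exact Finset.sum_comm
    _ ≤ _ := by
      refine Nat.add_le_add ?_ (Nat.add_le_add (Nat.mul_le_mul_left _ (sum_active_none_le hn))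
        (Finset.sum_le_sum fun o _ => sum_active_some_le hA hx o n))
      rw [← work_config_add hI hA x n]
      exact Nat.le_add_left _ _

/-- At most `P` processors are busy in a timestep, each executing one unit. -/
theorem totalWork_le_of_finished (hI : ∀ i, ∀ t ∈ I i, t.Pos) (hA : A.Valid) {x : ℕ → Choice P}
    {n : ℕ} (hn : (config I A x n).Finished) : totalWork I ≤ n * P := by
  rw [← work_config_add hI hA x n, hn.work_eq_zero, zero_add]
  refine (Finset.sum_le_card_nsmul _ _ P fun k _ => ?_).trans (by simp)
  simpa using Finset.card_le_univ (config I A x k).busy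

theorem runningTime_le {x : ℕ → Choice P} {n : ℕ} (h : (config I A x n).Finished) :
    runningTime I A x ≤ n := iInf₂_le n h

theorem le_runningTime (hP : 1 ≤ P) (hI : ∀ i, ∀ t ∈ I i, t.Pos) (hA : A.Valid)
    (x : ℕ → Choice P) : ENNReal.ofReal ((totalWork I : ℝ) / P) ≤ runningTime I A x := by
  refine le_iInf₂ fun n hn => ?_
  rw [← ENNReal.ofReal_natCast n]
  refine ENNReal.ofReal_le_ofReal ?_
  rw [div_le_iff₀ (by exact_mod_cast hP)]
  exact_mod_cast totalWork_le_of_finished hI hA hn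

theorem potential_init_le (S : Finset (Fin P)) :
    potential S (init I) ≤ P * (4 ^ inputHeight I - 1) := by
  refine (Finset.sum_le_card_nsmul _ _ (4 ^ inputHeight I - 1) fun q _ => ?_).trans (by simp)
  have := Finset.le_sup (f := fun i => (I i).elim 0 TaskTree.height) (Finset.mem_univ q)
  cases hq : I q with
  | none => simp [init, hq, heldPotential]
  | some t =>
    simp only [hq, Option.elim] at this
    have h4 := Nat.pow_le_pow_right (by norm_num : 0 < 4) this
    simp only [init, hq, Option.map_some, heldPotential, Option.elim, inputHeight]
    split_ifs <;> omega

end LocalizedWorkStealing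

/-! ### The expected drop of the potential in one random timestep. -/

namespace LocalizedWorkStealing

namespace Config

variable {P : ℕ}

theorem targets_nonempty (c : Config P) (i : Fin P) : (c.targets i).Nonempty := by
  rw [targets]
  split_ifs <;> simp_all

open Classical in
/-- The choice of a single processor is uniformly distributed on its targets. -/
theorem sum_choiceProb_ite (c : Config P) (i j : Fin P) :
    ∑ v, c.choiceProb v * (if v i = j then 1 else 0) =
      if j ∈ c.targets i then ((c.targets i).card : ℝ≥0∞)⁻¹ else 0 := by
  set f : Fin P → Fin P → ℝ≥0∞ := fun i j =>
    if j ∈ c.targets i then ((c.targets i).card : ℝ≥0∞)⁻¹ else 0 with hf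
  have h1 : ∀ i, ∑ j, f i j = 1 := by
    intro i
    simp only [hf]
    rw [← Finset.sum_filter, Finset.sum_const, Finset.filter_mem_eq_inter, Finset.univ_inter,
      nsmul_eq_mul]
    refine ENNReal.mul_inv_cancel ?_ (ENNReal.natCast_ne_top _)
    exact_mod_cast (Finset.card_pos.2 (c.targets_nonempty i)).ne'
  -- The event `v i = j` is written as a product over all processors, so that the sum over `v`
  -- factorizes.
  set g : Fin P → Fin P → ℝ≥0∞ := fun i' j' => f i' j' * if i' = i → j' = j then 1 else 0 with hg
  have h2 : ∀ v : Choice P, c.choiceProb v * (if v i = j then 1 else 0) = ∏ i', g i' (v i') := by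
    intro v
    simp only [hg]
    rw [Finset.prod_mul_distrib]
    congr 1
    rw [Finset.prod_eq_single i]
    · simp
    · intro i' _ hi'
      simp [hi']
    · simp
  rw [Finset.sum_congr rfl fun v _ => h2 v]
  have h3 := Finset.prod_univ_sum (fun _ : Fin P => (Finset.univ : Finset (Fin P))) g
  rw [Fintype.piFinset_univ] at h3
  rw [← h3, Finset.prod_eq_single i]
  · simp [hg, hf]
  · intro i' _ hi'
    simpa [hg, hi'] using h1 i'
  · simp

theorem sum_choiceProb (c : Config P) : ∑ v, c.choiceProb v = 1 := by
  have h3 := Finset.prod_univ_sum (fun _ : Fin P => (Finset.univ : Finset (Fin P)))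
    fun i j => if j ∈ c.targets i then ((c.targets i).card : ℝ≥0∞)⁻¹ else 0
  rw [Fintype.piFinset_univ] at h3
  simp only [choiceProb]
  rw [← h3]
  refine Finset.prod_eq_one fun i _ => ?_
  rw [← Finset.sum_filter, Finset.sum_const, Finset.filter_mem_eq_inter, Finset.univ_inter,
    nsmul_eq_mul]
  refine ENNReal.mul_inv_cancel ?_ (ENNReal.natCast_ne_top _)
  exact_mod_cast (Finset.card_pos.2 (c.targets_nonempty i)).ne'

theorem choiceProb_eq_zero {c : Config P} {v : Choice P} {i : Fin P} (h : v i ∉ c.targets i) :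
    c.choiceProb v = 0 :=
  Finset.prod_eq_zero (Finset.mem_univ i) (if_neg h)

/-- If a free processor can hit all work of the owners in `S`, then their potential decreases in
expectation. -/
theorem sum_choiceProb_potential {S : Finset (Fin P)} {c : Config P}
    {win : Choice P → Fin P → Finset (Fin P) → Fin P}
    (hwin : ∀ v q S, S.Nonempty → win v q S ∈ S) {i : Fin P} (hi : c.Free i)
    (hS : ∀ q o, o ∈ S → c.lootOwner q = some o →
      q ∈ c.targets i ∧ ((c.helpers i).Nonempty → o = i)) :
    2 * ∑ v, c.choiceProb v * (potential S (c.step v (win v)) : ℝ≥0∞) +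
      (P : ℝ≥0∞)⁻¹ * (potential S c : ℝ≥0∞) ≤ 2 * (potential S c : ℝ≥0∞) := by
  classical
  have h1 : (P : ℝ≥0∞)⁻¹ * (potential S c : ℝ≥0∞) ≤ ∑ v, c.choiceProb v *
      ((∑ q, if (c.contenders v q).Nonempty then heldPotential S (c.held q) else 0 : ℕ) :
        ℝ≥0∞) := by
    -- If `i` targets a tree of positive potential, then `i` itself competes for its branch; this
    -- suffices for the halving, whoever wins.
    have h2 : ∀ v, c.choiceProb v *
        ((∑ q, if (c.contenders v q).Nonempty then heldPotential S (c.held q) else 0 : ℕ) :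
        ℝ≥0∞) ≥ ∑ q, c.choiceProb v * (if v i = q then 1 else 0) *
          (heldPotential S (c.held q) : ℝ≥0∞) := by
      intro v
      rw [Nat.cast_sum, Finset.mul_sum]
      refine Finset.sum_le_sum fun q _ => ?_
      rw [mul_assoc]
      gcongr
      split_ifs with h3 h4 h4
      · simp
      · rcases Nat.eq_zero_or_pos (heldPotential S (c.held q)) with h0 | h0
        · simp [h0]
        · obtain ⟨o, t, ht, ho, hh⟩ := heldPotential_pos.1 h0
          have hl := lootOwner_eq_some.2 ⟨t, ht, hh⟩
          refine absurd ⟨i, Finset.mem_filter.2 ⟨Finset.mem_univ _, hi, h3, ?_, fun hne => ?_⟩⟩ h4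
          · have : (c.lootOwner q).isSome = true := by simp [hl]
            simpa [lootOwner] using this
          · rw [hl, (hS q o ho hl).2 hne]
      · simp
      · simp
    refine le_trans ?_ (Finset.sum_le_sum fun v _ => h2 v)
    rw [Finset.sum_comm, potential, Nat.cast_sum, Finset.mul_sum]
    refine Finset.sum_le_sum fun q _ => ?_
    rw [← Finset.sum_mul, sum_choiceProb_ite]
    rcases Nat.eq_zero_or_pos (heldPotential S (c.held q)) with h0 | h0
    · simp [h0]
    · obtain ⟨o, t, ht, ho, hh⟩ := heldPotential_pos.1 h0
      -- A uniform choice among at most `P` targets hits `q` with probability at least `1 / P`.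
      rw [if_pos (hS q o ho (lootOwner_eq_some.2 ⟨t, ht, hh⟩)).1]
      gcongr
      simpa using Finset.card_le_univ (c.targets i)
  calc _ ≤ 2 * ∑ v, c.choiceProb v * (potential S (c.step v (win v)) : ℝ≥0∞) +
      ∑ v, c.choiceProb v *
      ((∑ q, if (c.contenders v q).Nonempty then heldPotential S (c.held q) else 0 : ℕ) :
        ℝ≥0∞) := by gcongr
    _ = ∑ v, c.choiceProb v * ((2 * potential S (c.step v (win v)) +
        ∑ q, if (c.contenders v q).Nonempty then heldPotential S (c.held q) else 0 : ℕ) :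
          ℝ≥0∞) := by
      rw [Finset.mul_sum, ← Finset.sum_add_distrib]
      refine Finset.sum_congr rfl fun v _ => ?_
      push_cast
      ring
    _ ≤ ∑ v, c.choiceProb v * ((2 * potential S c : ℕ) : ℝ≥0∞) := by
      refine Finset.sum_le_sum fun v _ => ?_
      gcongr
      exact potential_step S c v (hwin v)
    _ = 2 * (potential S c : ℝ≥0∞) := by
      rw [← Finset.sum_mul, sum_choiceProb, one_mul]
      push_cast
      rfl

/-- The base of the exponential moments. -/
noncomputable def growth (P : ℕ) : ℝ≥0∞ := ENNReal.ofReal (1 + 1 / (4 * P))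

/-- Put `b = 1 / P`. From `y ≤ s - b s / 2` and `s ≥ (s + 1) / 2` follows `y + 1 ≤ (1 - b / 4) (s +
1)`, and `(1 + b / 4) (1 - b / 4) ≤ 1`. The added 1 keeps the moment at least `growth P ^ attempts`
even when the potential vanishes. -/
theorem growth_mul_le {P : ℕ} (hP : 1 ≤ P) {y : ℝ≥0∞} {s : ℕ} (hs : 0 < s)
    (h : 2 * y + (P : ℝ≥0∞)⁻¹ * (s : ℝ≥0∞) ≤ 2 * (s : ℝ≥0∞)) :
    growth P * (y + 1) ≤ s + 1 := by
  have hy : y ≠ ⊤ := by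
    rintro rfl
    rw [ENNReal.mul_top (by norm_num), top_add, top_le_iff] at h
    exact ENNReal.mul_ne_top (by norm_num) (ENNReal.natCast_ne_top _) h
  lift y to NNReal using hy
  have hP0 : (0 : ℝ) < P := by exact_mod_cast hP
  have hs1 : (1 : ℝ) ≤ s := by exact_mod_cast hs
  have h' : 2 * (y : ℝ) + (P : ℝ)⁻¹ * s ≤ 2 * s := by
    rw [show (P : ℝ≥0∞)⁻¹ = (((P : NNReal)⁻¹ : NNReal) : ℝ≥0∞) by
      rw [ENNReal.coe_inv (by exact_mod_cast hP0.ne'), ENNReal.coe_natCast]] at h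
    have h2 : ((2 * y + (P : NNReal)⁻¹ * s : NNReal) : ℝ≥0∞) ≤ ((2 * s : NNReal) : ℝ≥0∞) := by
      push_cast
      exact h
    have h3 := ENNReal.coe_le_coe.1 h2
    exact_mod_cast h3
  have key : (1 + 1 / (4 * (P : ℝ))) * (y + 1) ≤ s + 1 := by
    have hb : 0 < (P : ℝ)⁻¹ := inv_pos.2 hP0
    have e : 1 / (4 * (P : ℝ)) = (P : ℝ)⁻¹ / 4 := by
      field_simp
    rw [e]
    set b := (P : ℝ)⁻¹
    have h3 : (y : ℝ) ≤ s - b * s / 2 := by linarith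
    have h4 : (1 + b / 4) * (y + 1) ≤ (1 + b / 4) * (s - b * s / 2 + 1) := by gcongr
    nlinarith [mul_nonneg hb.le hb.le, mul_le_mul_of_nonneg_left hs1 hb.le,
      mul_nonneg (mul_nonneg hb.le hb.le) (zero_le_one.trans hs1)]
  rw [growth, show (y : ℝ≥0∞) + 1 = ENNReal.ofReal (y + 1) by
    rw [ENNReal.ofReal_add (NNReal.coe_nonneg y) zero_le_one, ENNReal.ofReal_coe_nnreal, ENNReal.ofReal_one],
    ← ENNReal.ofReal_mul (by positivity), show (s : ℝ≥0∞) + 1 = ENNReal.ofReal (s + 1) by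
    rw [ENNReal.ofReal_add (by positivity) zero_le_one, ENNReal.ofReal_natCast,
      ENNReal.ofReal_one]]
  exact ENNReal.ofReal_le_ofReal key

/-- Bernoulli's inequality: `(1 + 1 / (4 P)) ^ (4 P) ≥ 2`. -/
theorem two_pow_le_growth_pow {P : ℕ} (hP : 1 ≤ P) (L : ℕ) : 2 ^ L ≤ growth P ^ (4 * P * L) := by
  rw [pow_mul]
  refine pow_le_pow_left₀ (by norm_num) ?_ L
  have hP0 : (0 : ℝ) < P := by exact_mod_cast hP
  rw [growth, ← ENNReal.ofReal_pow (by positivity),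
    show (2 : ℝ≥0∞) = ENNReal.ofReal 2 by simp]
  refine ENNReal.ofReal_le_ofReal ?_
  have := one_add_mul_le_pow (a := 1 / (4 * (P : ℝ)))
    (by linarith [show 0 ≤ 1 / (4 * (P : ℝ)) by positivity]) (4 * P)
  refine le_trans ?_ this
  push_cast
  field_simp
  norm_num

theorem one_le_growth (P : ℕ) : 1 ≤ growth P := by
  rw [growth, ← ENNReal.ofReal_one]
  refine ENNReal.ofReal_le_ofReal ?_
  have : 0 ≤ 1 / (4 * (P : ℝ)) := by positivity
  linarith

/-- In a timestep with attempts of the kind `j`, the expected potential drops by a factor. -/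
theorem growth_mul_sum_le (hP : 1 ≤ P) {c : Config P} (hc : c.Listed) {j : Option (Fin P)}
    (hj : Active j c) (h0 : 0 < potential (group j) c)
    {win : Choice P → Fin P → Finset (Fin P) → Fin P}
    (hwin : ∀ v q S, S.Nonempty → win v q S ∈ S) :
    growth P * (∑ v, c.choiceProb v * (potential (group j) (c.step v (win v)) : ℝ≥0∞) + 1) ≤
      potential (group j) c + 1 := by
  refine growth_mul_le hP h0 ?_
  cases j with
  | none =>
    obtain ⟨i, hf, hh⟩ := hj
    refine sum_choiceProb_potential hwin hf fun q o ho hl => ⟨?_, fun h => absurd h hh⟩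
    obtain ⟨t, ht, -⟩ := lootOwner_eq_some.1 hl
    have hq : q ∈ c.busy := Finset.mem_filter.2 ⟨Finset.mem_univ _, by simp [Free, ht]⟩
    rw [targets, if_pos hf, if_neg hh, if_pos ⟨q, hq⟩]
    exact hq
  | some i =>
    obtain ⟨hf, hh⟩ := hj
    refine sum_choiceProb_potential hwin hf fun q o ho hl => ?_
    obtain rfl : o = i := Finset.mem_singleton.1 ho
    refine ⟨?_, fun _ => rfl⟩
    rw [targets, if_pos hf, if_pos hh]
    refine hc q o ?_ hl
    -- The stealer is free, so the holder of the branch is another processor and `Listed` applies to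
    -- it.
    rintro rfl
    obtain ⟨t, ht, -⟩ := lootOwner_eq_some.1 hl
    simp [hf.held_eq] at ht

end Config

open Config

variable {P : ℕ} {I : Input P} {A : Arbiter P} {Ω : Type*} [MeasurableSpace Ω] {μ : Measure Ω}
  {X : ℕ → Ω → Choice P}

/-! ### Expectations over finite histories and the supermartingale. -/

/-- Extends a finite sequence of choices. -/
def extend {n : ℕ} (h : Fin n → Choice P) (k : ℕ) : Choice P :=
  -- The default is immaterial: the functions evaluated here depend only on the first `n` choices.
  if hk : k < n then h ⟨k, hk⟩ else id

theorem eq_extend {β : Type*} {n : ℕ} {f : (ℕ → Choice P) → β}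
    (hf : ∀ x y, (∀ k < n, x k = y k) → f x = f y) (x : ℕ → Choice P) :
    f x = f (extend fun k : Fin n => x k) :=
  hf _ _ fun k hk => by simp [extend, hk]

theorem measurable_prefix (hX : ∀ n, Measurable (X n)) (n : ℕ) :
    Measurable fun ω => fun k : Fin n => X k ω :=
  measurable_pi_lambda _ fun k => hX k

theorem measurable_of_prefix {β : Type*} [MeasurableSpace β] (hX : ∀ n, Measurable (X n)) {n : ℕ}
    {f : (ℕ → Choice P) → β} (hf : ∀ x y, (∀ k < n, x k = y k) → f x = f y) :
    Measurable fun ω => f fun k => X k ω := by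
  have : (fun ω => f fun k => X k ω) =
      (fun h : Fin n → Choice P => f (extend h)) ∘ fun ω => fun k : Fin n => X k ω := by
    funext ω
    exact eq_extend hf _
  rw [this]
  exact (measurable_of_finite _).comp (measurable_prefix hX n)

/-- There are finitely many histories of length `n`, so the integral is a finite sum and no
conditional expectations are needed. -/
theorem setLIntegral_prefix (hX : ∀ n, Measurable (X n)) {n : ℕ}
    {f : (ℕ → Choice P) → ℝ≥0∞} (hf : ∀ x y, (∀ k < n, x k = y k) → f x = f y) (B : Set Ω) :
    ∫⁻ ω in B, f (fun k => X k ω) ∂μ =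
      ∑ h : Fin n → Choice P, f (extend h) * μ ({ω | ∀ k < n, X k ω = extend h k} ∩ B) := by
  have hm := measurable_prefix hX n
  rw [lintegral_congr fun ω => eq_extend hf fun k => X k ω,
    ← lintegral_map (f := fun h : Fin n → Choice P => f (extend h)) (measurable_of_finite _) hm,
    lintegral_fintype]
  refine Finset.sum_congr rfl fun h _ => ?_
  rw [Measure.map_apply hm (measurableSet_singleton h),
    Measure.restrict_apply (hm (measurableSet_singleton h))]
  congr 3
  ext ω
  simp only [Set.mem_preimage, Set.mem_singleton_iff, Set.mem_ofPred_eq, funext_iff, extend]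
  constructor
  · intro hk k hkn
    simp only [hkn, dif_pos]
    exact hk ⟨k, hkn⟩
  · intro hk k
    have := hk k k.2
    simpa only [k.2, dif_pos] using this

/-- Taking the expectation over the choices in timestep `n`. -/
theorem IsExecution.lintegral_le (hX : IsExecution I A μ X) {n : ℕ} {G H : (ℕ → Choice P) → ℝ≥0∞}
    (hG : ∀ x y, (∀ k < n + 1, x k = y k) → G x = G y)
    (hH : ∀ x y, (∀ k < n, x k = y k) → H x = H y)
    (h : ∀ x, ∑ v, (config I A x n).choiceProb v * G (Function.update x n v) ≤ H x) :
    ∫⁻ ω, G (fun k => X k ω) ∂μ ≤ ∫⁻ ω, H (fun k => X k ω) ∂μ := by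
  have hGv : ∀ v x y, (∀ k < n, x k = y k) →
      G (Function.update x n v) = G (Function.update y n v) := by
    intro v x y hxy
    refine hG _ _ fun k hk => ?_
    rcases Nat.lt_succ_iff_lt_or_eq.1 hk with hk | rfl
    · simp [hk.ne, hxy k hk]
    · simp
  have h1 : ∀ ω, G (fun k => X k ω) = ∑ v, (X n ⁻¹' {v}).indicator
      (fun ω => G (Function.update (fun k => X k ω) n v)) ω := by
    intro ω
    rw [Finset.sum_eq_single (X n ω)]
    · simp
    · intro v _ hv
      rw [Set.indicator_of_notMem]
      exact fun hv' => hv hv'.symm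
    · simp
  have hmv : ∀ v, MeasurableSet (X n ⁻¹' {v}) := fun v =>
    hX.measurable n (measurableSet_singleton v)
  rw [lintegral_congr h1, lintegral_finsetSum _ fun v _ =>
    (measurable_of_prefix hX.measurable (hGv v)).indicator (hmv v)]
  have h2 : ∀ v, ∫⁻ ω, (X n ⁻¹' {v}).indicator
      (fun ω => G (Function.update (fun k => X k ω) n v)) ω ∂μ =
      ∑ h : Fin n → Choice P, μ {ω | ∀ k < n, X k ω = extend h k} *
        ((config I A (extend h) n).choiceProb v * G (Function.update (extend h) n v)) := by
    intro v
    rw [lintegral_indicator (hmv v), setLIntegral_prefix hX.measurable (hGv v)]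
    refine Finset.sum_congr rfl fun h _ => ?_
    have h3 := hX.law n (Function.update (extend h) n v)
    have h4 : ∀ k < n, Function.update (extend h) n v k = extend h k := fun k hk => by
      simp [hk.ne]
    rw [config_congr h4, Function.update_self] at h3
    have h5 : {ω | ∀ k < n, X k ω = extend h k} ∩ X n ⁻¹' {v} =
        {ω | ∀ k < n + 1, X k ω = Function.update (extend h) n v k} := by
      ext ω
      constructor
      · rintro ⟨ha, hb⟩ k hk
        rcases Nat.lt_succ_iff_lt_or_eq.1 hk with hk | rfl
        · rw [h4 k hk, ha k hk]
        · simpa using hb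
      · intro ha
        refine ⟨fun k hk => by rw [ha k (hk.trans n.lt_succ_self), h4 k hk], ?_⟩
        simpa using ha n n.lt_succ_self
    have h6 : {ω | ∀ k < n, X k ω = Function.update (extend h) n v k} =
        {ω | ∀ k < n, X k ω = extend h k} := by
      ext ω
      exact forall₂_congr fun k hk => by rw [h4 k hk]
    rw [h5, h3, h6]
    ring
  rw [Finset.sum_congr rfl fun v _ => h2 v, Finset.sum_comm, ← setLIntegral_univ,
    setLIntegral_prefix hX.measurable hH]
  refine Finset.sum_le_sum fun h' _ => ?_
  rw [← Finset.mul_sum, Set.inter_univ, mul_comm]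
  gcongr
  exact h _

/-- At each of the countably many timesteps, a choice outside the targets has probability zero. -/
theorem IsExecution.ae_legal (hX : IsExecution I A μ X) :
    ∀ᵐ ω ∂μ, Legal I A fun n => X n ω := by
  classical
  simp only [Legal]
  refine ae_all_iff.2 fun n => ?_
  set G : (ℕ → Choice P) → ℝ≥0∞ := fun x => if ∀ o, Active (some o) (config I A x n) →
    x n o ∈ (config I A x n).helpers o then 0 else 1 with hGdef
  have hG : ∀ x y, (∀ k < n + 1, x k = y k) → G x = G y := by
    intro x y hxy
    simp only [hGdef, config_congr (I := I) (A := A) fun k hk => hxy k (Nat.lt_succ_of_lt hk),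
      hxy n n.lt_succ_self]
  have h1 : ∫⁻ ω, G (fun k => X k ω) ∂μ = 0 := by
    refine le_antisymm ((hX.lintegral_le (H := 0) hG (fun _ _ _ => rfl) fun x => ?_).trans
      (by simp)) zero_le
    refine (Finset.sum_eq_zero fun v _ => ?_).le
    have hc : config I A (Function.update x n v) n = config I A x n :=
      config_congr fun k hk => by simp [hk.ne]
    simp only [hGdef, hc, Function.update_self]
    split_ifs with h2
    · simp
    · rw [not_forall] at h2
      obtain ⟨o, ho⟩ := h2
      rw [Classical.not_imp] at ho
      rw [choiceProb_eq_zero (i := o), zero_mul]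
      rw [targets, if_pos ho.1.1, if_pos ho.1.2]
      exact ho.2
  rw [lintegral_eq_zero_iff (measurable_of_prefix hX.measurable hG)] at h1
  filter_upwards [h1] with ω hω
  by_contra hne
  simp [hGdef, hne] at hω

/-- The exponential moment for the attempts of the kind `j`. -/
noncomputable def moment (I : Input P) (A : Arbiter P) (j : Option (Fin P)) (n : ℕ)
    (x : ℕ → Choice P) : ℝ≥0∞ :=
  growth P ^ attempts I A j x n * (potential (group j) (config I A x n) + 1)

theorem moment_congr {j : Option (Fin P)} {n : ℕ} {x y : ℕ → Choice P}
    (h : ∀ k < n, x k = y k) : moment I A j n x = moment I A j n y := by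
  have : attempts I A j x n = attempts I A j y n := by
    classical
    refine Finset.sum_congr rfl fun k hk => ?_
    rw [config_congr fun l hl => h l (hl.trans (Finset.mem_range.1 hk))]
  rw [moment, moment, this, config_congr h]

/-- The supermartingale property. A counted attempt contributes a factor `growth P`, which the
expected drop compensates; otherwise it suffices that the potential never rises. -/
theorem sum_moment_le (hP : 1 ≤ P) (hA : A.Valid) (j : Option (Fin P)) (n : ℕ)
    (x : ℕ → Choice P) :
    ∑ v, (config I A x n).choiceProb v * moment I A j (n + 1) (Function.update x n v) ≤
      moment I A j n x := by
  classical
  set c := config I A x n with hcdef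
  have hc : ∀ v, ∀ k ≤ n, config I A (Function.update x n v) k = config I A x k := fun v k hk =>
    config_congr fun l hl => by simp [(hl.trans_le hk).ne]
  set e : ℕ := if Active j c ∧ 0 < potential (group j) c then 1 else 0 with he
  have ha : ∀ v, attempts I A j (Function.update x n v) (n + 1) = attempts I A j x n + e := by
    intro v
    rw [attempts, Finset.sum_range_succ, hc v n le_rfl]
    congr 1
    refine Finset.sum_congr rfl fun k hk => ?_
    rw [hc v k (Finset.mem_range.1 hk).le]
  set win : Choice P → Fin P → Finset (Fin P) → Fin P := fun v =>
    A ((List.range (n + 1)).map (Function.update x n v)) with hwin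
  have hs : ∀ v, config I A (Function.update x n v) (n + 1) = c.step v (win v) := by
    intro v
    rw [config, hc v n le_rfl, Function.update_self]
  have key : growth P ^ e *
      (∑ v, c.choiceProb v * (potential (group j) (c.step v (win v)) : ℝ≥0∞) + 1) ≤
      potential (group j) c + 1 := by
    rw [he]
    split_ifs with h
    · rw [pow_one]
      exact growth_mul_sum_le hP (config_listed x n) h.1 h.2 fun v => hA _
    · rw [pow_zero, one_mul]
      gcongr
      calc _ ≤ ∑ v, c.choiceProb v * (potential (group j) c : ℝ≥0∞) := by
            refine Finset.sum_le_sum fun v _ => ?_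
            gcongr
            have := potential_step (group j) c v (win := win v) (hA _)
            omega
        _ = _ := by rw [← Finset.sum_mul, sum_choiceProb, one_mul]
  calc _ = growth P ^ attempts I A j x n * (growth P ^ e *
      (∑ v, c.choiceProb v * (potential (group j) (c.step v (win v)) : ℝ≥0∞) + 1)) := by
        -- The summand 1 is spread over the choices as their total probability.
        nth_rewrite 1 [← sum_choiceProb c]
        rw [← Finset.sum_add_distrib, Finset.mul_sum, Finset.mul_sum]
        refine Finset.sum_congr rfl fun v _ => ?_
        rw [moment, ha, hs, pow_add]
        ring
    _ ≤ _ := by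
        rw [moment]
        gcongr

theorem IsExecution.lintegral_moment_le [IsProbabilityMeasure μ] (hX : IsExecution I A μ X)
    (hP : 1 ≤ P) (hA : A.Valid) (j : Option (Fin P)) (n : ℕ) :
    ∫⁻ ω, moment I A j n (fun k => X k ω) ∂μ ≤ (P * 4 ^ inputHeight I : ℕ) := by
  induction n with
  | zero =>
    have h1 : ∀ x : ℕ → Choice P, moment I A j 0 x = (potential (group j) (init I) + 1 : ℕ) := by
      intro x
      simp [moment, attempts, config]
    simp only [h1, lintegral_const, measure_univ, mul_one]
    have h2 := potential_init_le (I := I) (group j)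
    have h3 := Nat.pow_pos (n := inputHeight I) (by norm_num : 0 < 4)
    rw [Nat.mul_sub, mul_one] at h2
    have h4 : P ≤ P * 4 ^ inputHeight I := Nat.le_mul_of_pos_right _ h3
    exact_mod_cast (by omega : potential (group j) (init I) + 1 ≤ P * 4 ^ inputHeight I)
  | succ n ih =>
    exact (hX.lintegral_le (fun _ _ h => moment_congr h) (fun _ _ h => moment_congr h)
      (sum_moment_le hP hA j n)).trans ih

end LocalizedWorkStealing

/-! ### Tail bound, expectation and conclusion. -/

namespace LocalizedWorkStealing

open Config

variable {P : ℕ} {I : Input P} {A : Arbiter P} {Ω : Type*} [MeasurableSpace Ω] {μ : Measure Ω}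
  {X : ℕ → Ω → Choice P}

theorem finished_congr {n : ℕ} {x y : ℕ → Choice P} (h : ∀ k < n, x k = y k) :
    (config I A x n).Finished = (config I A y n).Finished := by
  rw [config_congr h]

theorem IsExecution.measurableSet_not_finished (hX : IsExecution I A μ X) (n : ℕ) :
    MeasurableSet {ω | ¬ (config I A (fun k => X k ω) n).Finished} :=
  (measurableSet_setOfPred.2
    (measurable_of_prefix (f := fun x => (config I A x n).Finished) hX.measurable
      fun _ _ h => finished_congr h)).compl

/-- Bounds the sum of the `P + 1` initial moments, each at most `P * 4 ^ inputHeight I`. -/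
theorem succ_mul_le_two_pow (I : Input P) :
    (P + 1) * (P * 4 ^ inputHeight I) ≤ 2 ^ (2 * (Nat.clog 2 P + inputHeight I) + 1) := by
  have h1 : P ≤ 2 ^ Nat.clog 2 P := Nat.le_pow_clog (by norm_num) P
  have h2 : 1 ≤ 2 ^ Nat.clog 2 P := Nat.one_le_two_pow
  calc (P + 1) * (P * 4 ^ inputHeight I)
      ≤ (2 * 2 ^ Nat.clog 2 P) * (2 ^ Nat.clog 2 P * 4 ^ inputHeight I) := by
        gcongr
        omega
    _ = _ := by
        rw [show (4 : ℕ) = 2 ^ 2 by norm_num, ← pow_mul]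
        ring

/-- The probability that there is work left after many timesteps. -/
theorem IsExecution.measure_not_finished_le [IsProbabilityMeasure μ] (hX : IsExecution I A μ X)
    (hP : 1 ≤ P) (hI : ∀ i, ∀ t ∈ I i, t.Pos) (hA : A.Valid) {n J : ℕ}
    (hn : totalWork I + P * (8 * P * (2 * (Nat.clog 2 P + inputHeight I) + 1 + J) +
      inputMaxTask I + P) < n * P) :
    μ {ω | ¬ (config I A (fun k => X k ω) n).Finished} ≤ 2⁻¹ ^ J := by
  set b := 2 * (Nat.clog 2 P + inputHeight I) + 1 with hb
  set F : Ω → ℝ≥0∞ := fun ω => ∑ j, moment I A j n (fun k => X k ω) with hF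
  have hm : ∀ j, Measurable fun ω => moment I A j n fun k => X k ω := fun j =>
    measurable_of_prefix hX.measurable fun _ _ h => moment_congr h
  have hFm : Measurable F := Finset.measurable_sum _ fun j _ => hm j
  have hint : ∫⁻ ω, F ω ∂μ ≤ 2 ^ b := by
    simp only [hF]
    rw [lintegral_finsetSum _ fun j _ => hm j]
    refine (Finset.sum_le_card_nsmul _ _ _ fun j _ => hX.lintegral_moment_le hP hA j n).trans ?_
    rw [Finset.card_univ, Fintype.card_option, Fintype.card_fin, nsmul_eq_mul]
    exact_mod_cast succ_mul_le_two_pow I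
  have hsub : μ {ω | ¬ (config I A (fun k => X k ω) n).Finished} ≤ μ {ω | 2 ^ (b + J) ≤ F ω} := by
    refine measure_mono_ae ?_
    filter_upwards [hX.ae_legal] with ω hω hnf
    have hle := mul_le_of_not_finished hI hA hω hnf
    -- Otherwise general steals and the `P` owners would each account for at most `P * (4 P (b +
    -- J))` counted processor steps. Together these give the `8 P` in `hn`, contradicting the
    -- accounting.
    obtain ⟨j, hj⟩ : ∃ j, 4 * P * (b + J) ≤ attempts I A j (fun k => X k ω) n := by
      by_contra! hlt
      have hs : ∑ o, (attempts I A (some o) (fun k => X k ω) n + P) ≤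
          P * (4 * P * (b + J) + P) := by
        refine (Finset.sum_le_card_nsmul _ _ (4 * P * (b + J) + P) fun o _ => ?_).trans (by simp)
        exact Nat.add_le_add_right (hlt _).le _
      have h0 := Nat.mul_le_mul_left P
        (Nat.add_le_add_right (hlt none).le (inputMaxTask I))
      nlinarith
    calc (2 : ℝ≥0∞) ^ (b + J) ≤ growth P ^ (4 * P * (b + J)) := two_pow_le_growth_pow hP _
      _ ≤ growth P ^ attempts I A j (fun k => X k ω) n := pow_le_pow_right₀ (one_le_growth P) hj
      _ ≤ moment I A j n (fun k => X k ω) := by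
        rw [moment]
        exact le_mul_of_one_le_right' le_add_self
      _ ≤ F ω := Finset.single_le_sum (f := fun j => moment I A j n (fun k => X k ω))
        (fun _ _ => zero_le) (Finset.mem_univ j)
  refine hsub.trans ((meas_ge_le_lintegral_div hFm.aemeasurable (by simp) (by simp)).trans ?_)
  refine (ENNReal.div_le_div_right hint _).trans ?_
  clear_value b
  rw [pow_add, ENNReal.div_eq_inv_mul, ENNReal.mul_inv (by simp) (by simp), mul_right_comm,
    ENNReal.inv_mul_cancel (by simp) (by simp), one_mul, ENNReal.inv_pow]

theorem span_eq (I : Input P) :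
    span I = Nat.clog 2 P + inputHeight I + inputMaxTask I := rfl

/-- A number of timesteps which suffices with constant probability. -/
def baseTime (I : Input P) : ℕ :=
  -- The last 1 makes up for the rounding in `totalWork I / P` and yields a strict inequality.
  totalWork I / P + (8 * P * (2 * (Nat.clog 2 P + inputHeight I) + 1) + inputMaxTask I + P + 1)

theorem IsExecution.measure_not_finished_baseTime_le [IsProbabilityMeasure μ]
    (hX : IsExecution I A μ X) (hP : 1 ≤ P) (hI : ∀ i, ∀ t ∈ I i, t.Pos) (hA : A.Valid) (J : ℕ) :
    μ {ω | ¬ (config I A (fun k => X k ω) (baseTime I + 8 * P * J)).Finished} ≤ 2⁻¹ ^ J := by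
  refine hX.measure_not_finished_le hP hI hA ?_
  have h := Nat.lt_div_mul_add (a := totalWork I) hP
  rw [baseTime]
  set q := totalWork I / P
  nlinarith

theorem baseTime_le (hP : 1 ≤ P) (hs : 1 ≤ span I) :
    (baseTime I : ℝ) ≤ (totalWork I : ℝ) / P + 27 * (span I * P) := by
  have h1 : ((totalWork I / P : ℕ) : ℝ) ≤ (totalWork I : ℝ) / P := Nat.cast_div_le
  have h2 : 8 * P * (2 * (Nat.clog 2 P + inputHeight I) + 1) + inputMaxTask I + P + 1 ≤
      27 * (span I * P) := by
    rw [span_eq] at hs ⊢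
    set a := Nat.clog 2 P + inputHeight I
    nlinarith [Nat.mul_le_mul hs hP, Nat.mul_le_mul hs (le_refl P),
      Nat.mul_le_mul (le_refl (inputMaxTask I)) hP]
  have h3 : ((8 * P * (2 * (Nat.clog 2 P + inputHeight I) + 1) + inputMaxTask I + P + 1 : ℕ) : ℝ) ≤
      27 * (span I * P) := by exact_mod_cast h2
  rw [baseTime, Nat.cast_add]
  linarith

/-- Span zero means that there are no tasks at all. This case is separate because the additive
constants in `baseTime` can be absorbed only if the span is positive. -/
theorem runningTime_eq_zero (hI : ∀ i, ∀ t ∈ I i, t.Pos) (hs : span I = 0) (x : ℕ → Choice P) :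
    runningTime I A x = 0 := by
  have hm : inputMaxTask I = 0 := by
    rw [span_eq] at hs
    omega
  have h0 : (config I A x 0).Finished := by
    intro i
    have h2 : (I i).elim 0 TaskTree.maxTask ≤ inputMaxTask I :=
      Finset.le_sup (f := fun i => (I i).elim 0 TaskTree.maxTask) (Finset.mem_univ i)
    cases hi : I i with
    | none => simp [config, init, Free, hi]
    | some t =>
      have h1 := (hI i t hi).maxTask_pos
      rw [hi, hm, Option.elim] at h2
      omega
  simpa using runningTime_le h0

/-- The execution time in terms of the first timestep `n + D * J` after which nothing is left. -/
theorem runningTime_le_tsum (I : Input P) (A : Arbiter P) (x : ℕ → Choice P) (n D : ℕ)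
    (hD : 0 < D) :
    runningTime I A x ≤ n + ∑' J : ℕ,
      {y : ℕ → Choice P | ¬ (config I A y (n + D * J)).Finished}.indicator
        (fun _ => (D : ℝ≥0∞)) x := by
  classical
  by_cases h : ∃ J, (config I A x (n + D * J)).Finished
  · refine (runningTime_le (Nat.find_spec h)).trans ?_
    rw [Nat.cast_add]
    gcongr
    refine le_trans ?_ (ENNReal.sum_le_tsum (Finset.range (Nat.find h)))
    rw [Finset.sum_congr rfl fun J hJ => Set.indicator_of_mem
      (show x ∈ {y : ℕ → Choice P | ¬ (config I A y (n + D * J)).Finished} from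
        Nat.find_min h (Finset.mem_range.1 hJ)) _]
    simp [mul_comm]
  -- If no such timestep is reached, all terms equal `D > 0` and the series diverges.
  · rw [not_exists] at h
    rw [tsum_congr fun J => Set.indicator_of_mem
      (show x ∈ {y : ℕ → Choice P | ¬ (config I A y (n + D * J)).Finished} from h J) _]
    rw [ENNReal.tsum_const_eq_top_of_ne_zero (by exact_mod_cast hD.ne'), add_top]
    exact le_top

theorem IsExecution.lintegral_runningTime_le [IsProbabilityMeasure μ] (hX : IsExecution I A μ X)
    (hP : 1 ≤ P) (hI : ∀ i, ∀ t ∈ I i, t.Pos) (hA : A.Valid) :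
    ∫⁻ ω, runningTime I A (fun k => X k ω) ∂μ ≤ (baseTime I + 16 * P : ℕ) := by
  calc ∫⁻ ω, runningTime I A (fun k => X k ω) ∂μ
      ≤ ∫⁻ ω, (baseTime I + ∑' J : ℕ,
        {ω | ¬ (config I A (fun k => X k ω) (baseTime I + 8 * P * J)).Finished}.indicator
          (fun _ => ((8 * P : ℕ) : ℝ≥0∞)) ω) ∂μ :=
        lintegral_mono fun ω => runningTime_le_tsum I A _ (baseTime I) (8 * P) (by omega)
    _ = baseTime I + ∑' J : ℕ, (8 * P : ℕ) *
        μ {ω | ¬ (config I A (fun k => X k ω) (baseTime I + 8 * P * J)).Finished} := by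
        rw [lintegral_add_left measurable_const, lintegral_const, measure_univ, mul_one,
          lintegral_tsum fun J => (measurable_const.indicator
            (hX.measurableSet_not_finished _)).aemeasurable]
        congr 1
        exact tsum_congr fun J => lintegral_indicator_const (hX.measurableSet_not_finished _) _
    _ ≤ baseTime I + ∑' J : ℕ, (8 * P : ℕ) * (2⁻¹ : ℝ≥0∞) ^ J := by
        gcongr with J
        exact hX.measure_not_finished_baseTime_le hP hI hA J
    _ = _ := by
        rw [ENNReal.tsum_mul_left, ENNReal.tsum_geometric, ENNReal.one_sub_inv_two, inv_inv]
        push_cast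
        ring

theorem IsExecution.le_measure_runningTime_le [IsProbabilityMeasure μ] (hX : IsExecution I A μ X)
    (hP : 1 ≤ P) (hI : ∀ i, ∀ t ∈ I i, t.Pos) (hA : A.Valid) (hs : 1 ≤ span I) {ε : ℝ}
    (hε : 0 < ε) (hε1 : ε < 1) :
    ENNReal.ofReal (1 - ε) ≤ μ {ω | runningTime I A (fun k => X k ω) ≤
      ENNReal.ofReal ((totalWork I : ℝ) / P + 43 * (P * (span I + Real.logb 2 (P / ε))))} := by
  have hP1 : (1 : ℝ) ≤ P := by exact_mod_cast hP
  have hs1 : (1 : ℝ) ≤ span I := by exact_mod_cast hs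
  set l := Real.logb 2 (P / ε) with hl
  have hl0 : 0 ≤ l := Real.logb_nonneg (by norm_num) ((one_le_div hε).2 (hε1.le.trans hP1))
  set J := ⌈l⌉₊ with hJ
  have hJl : l ≤ J := Nat.le_ceil l
  have hJu : (J : ℝ) < l + 1 := Nat.ceil_lt_add_one hl0
  have hJε : (2⁻¹ : ℝ≥0∞) ^ J ≤ ENNReal.ofReal ε := by
    rw [show (2⁻¹ : ℝ≥0∞) = ENNReal.ofReal 2⁻¹ by
      rw [ENNReal.ofReal_inv_of_pos (by norm_num), ENNReal.ofReal_ofNat],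
      ← ENNReal.ofReal_pow (by norm_num)]
    refine ENNReal.ofReal_le_ofReal ?_
    rw [inv_pow]
    refine inv_le_of_inv_le₀ hε ?_
    -- The tail is even at most `ε / P`; only `ε` is needed.
    have h1 : P / ε ≤ 2 ^ J := by
      rw [← Real.rpow_natCast]
      exact (Real.logb_le_iff_le_rpow (by norm_num) (by positivity)).1 hJl
    refine le_trans ?_ h1
    rw [← one_div]
    gcongr
  set E := {ω | runningTime I A (fun k => X k ω) ≤
      ENNReal.ofReal ((totalWork I : ℝ) / P + 43 * (P * (span I + l)))} with hE
  have hsub : Eᶜ ⊆ {ω | ¬ (config I A (fun k => X k ω) (baseTime I + 8 * P * J)).Finished} := by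
    intro ω hω hf
    refine hω ((runningTime_le hf).trans ?_)
    rw [← ENNReal.ofReal_natCast]
    refine ENNReal.ofReal_le_ofReal ?_
    have h1 := baseTime_le hP hs
    push_cast
    have h2 : 8 * (P : ℝ) * J ≤ 8 * P * (l + 1) := by gcongr
    have h3 : (P : ℝ) ≤ P * span I := le_mul_of_one_le_right (by linarith) hs1
    have h4 : 0 ≤ P * l := by positivity
    nlinarith
  have h1 : 1 ≤ μ E + ENNReal.ofReal ε := by
    calc 1 = μ (E ∪ Eᶜ) := by rw [Set.union_compl_self, measure_univ]
      _ ≤ μ E + μ Eᶜ := measure_union_le _ _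
      _ ≤ _ := by
        gcongr
        exact ((measure_mono hsub).trans
          (hX.measure_not_finished_baseTime_le hP hI hA J)).trans hJε
  rw [ENNReal.ofReal_sub _ hε.le, ENNReal.ofReal_one]
  exact tsub_le_iff_right.2 h1

end LocalizedWorkStealing

open LocalizedWorkStealing in
theorem theorem4 :
    ∃ C : ℝ, 0 < C ∧
      ∀ (P : ℕ), 1 ≤ P →
      ∀ (I : Input P), (∀ i, ∀ t ∈ I i, t.Pos) →
      ∀ (A : Arbiter P), A.Valid →
      ∀ (Ω : Type*) [MeasurableSpace Ω] (μ : Measure Ω) [IsProbabilityMeasure μ]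
        (X : ℕ → Ω → Choice P), IsExecution I A μ X →
        (ENNReal.ofReal ((totalWork I : ℝ) / P) ≤ ∫⁻ ω, runningTime I A (fun n => X n ω) ∂μ ∧
          ∫⁻ ω, runningTime I A (fun n => X n ω) ∂μ ≤
            ENNReal.ofReal ((totalWork I : ℝ) / P + C * (span I * P))) ∧
        ∀ ε : ℝ, 0 < ε →
          ENNReal.ofReal (1 - ε) ≤
            μ {ω | ENNReal.ofReal ((totalWork I : ℝ) / P) ≤ runningTime I A (fun n => X n ω) ∧
              runningTime I A (fun n => X n ω) ≤
                ENNReal.ofReal ((totalWork I : ℝ) / P +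
                  C * (P * (span I + Real.logb 2 (P / ε))))} := by
  -- `43 = 27 + 16`: 27 from `baseTime_le`, and 16 from the geometric series of blocks of `8 P`
  -- timesteps. It also covers the high-probability bound.
  refine ⟨43, by norm_num, fun P hP I hI A hA Ω _ μ _ X hX => ⟨⟨?_, ?_⟩, fun ε hε => ?_⟩⟩
  · calc _ = ∫⁻ _, ENNReal.ofReal ((totalWork I : ℝ) / P) ∂μ := by simp
      _ ≤ _ := lintegral_mono fun ω => le_runningTime hP hI hA _
  · rcases Nat.eq_zero_or_pos (span I) with hs | hs
    · simp [runningTime_eq_zero hI hs]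
    · refine (hX.lintegral_runningTime_le hP hI hA).trans ?_
      rw [← ENNReal.ofReal_natCast]
      refine ENNReal.ofReal_le_ofReal ?_
      have h1 := baseTime_le hP hs
      have h2 : (1 : ℝ) ≤ span I := by exact_mod_cast hs
      push_cast
      nlinarith [mul_le_mul_of_nonneg_right h2 (Nat.cast_nonneg (α := ℝ) P)]
  · simp only [le_runningTime hP hI hA, true_and]
    rcases le_or_gt 1 ε with hε1 | hε1
    · rw [ENNReal.ofReal_of_nonpos (by linarith)]
      exact zero_le
    · rcases Nat.eq_zero_or_pos (span I) with hs | hs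
      · simp only [runningTime_eq_zero hI hs, zero_le, Set.ofPred_true, measure_univ]
        exact ENNReal.ofReal_le_one.2 (by linarith)
      · exact hX.le_measure_runningTime_le hP hI hA hs hε hε1
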